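/- Let $p,q\ge 0$ and $n=p+q$. A $(p,q)$-clan is a partial matching (a set of arcs) of the vertices $1,\dots,n$ in which every unpaired vertex carries a sign $+$ or $-$, such that the number of $+$'s minus the number of $-$'s is $p-q$. It is non-crossing if there are no $a<b<c<d$ with $a$ matched to $c$ and $b$ matched to $d$, and matchless if it has no arcs. For a non-crossing clan $\gamma$ let $u(\gamma)\in S_n$ (in one-line notation) assign the labels $1,\dots,q$ from left to right to the $-$'s and the left ends of arcs, and the labels $q+1,\dots,n$ from left to right to the $+$'s and the right ends of arcs; let $v(\gamma)\in S_n$ assign $1,\dots,p$ from left to right to the $+$'s and the left ends of arcs, and $p+1,\dots,n$ from left to right to the $-$'s and the right ends of arcs. The $\beta$-double Schubert polynomials $\mathfrak S^{(\beta)}_w(X;Y)\in\mathbb Z[\beta][Y][X]$, $w\in S_n$, $X=\{x_1,\dots,x_n\}$, $Y=\{y_1,\dots,y_n\}$, are defined by $$\mathfrak S^{(\beta)}_{w_0}(X;Y)=\prod_{i=1}^{n-1}\prod_{j=1}^{n-i}(x_i-y_j+\beta x_iy_j),\qquad \mathfrak S^{(\beta)}_w=\partial^{(\beta)}_i\,\mathfrak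 S^{(\beta)}_{ws_i}\ \text{ whenever } w(i)<w(i+1),$$ where $w_0$ is the longest element, $s_i$ is the transposition of $i$ and $i+1$, $\partial_i^{(\beta)}(f)=\partial_i((1-\beta x_{i+1})f)$, and $\partial_i f=(f-f^{s_i})/(x_i-x_{i+1})$, with $s_i$ acting on $X$ only. (1) If $\gamma$ is a non-crossing $(p,q)$-clan and $$\mathfrak S^{(\beta)}_{u(\gamma)}(X;y_n,y_{n-1},\dots,y_1)\,\mathfrak S^{(\beta)}_{v(\gamma)}(X;Y)=\sum_{\kappa}c^{(\beta)}_\kappa(Y)\,x^\kappa,\qquad c^{(\beta)}_\kappa(Y)\in\mathbb Z[\beta][Y],$$ then $c^{(\beta)}_\kappa(Y)=0$ unless $\kappa\le(n-1,n-2,\dots,1,0)$ componentwise. (2) If $\tau$ is a matchless $(p,q)$-clan, then $\Upsilon^{(\beta)}_\tau(X;Y):=\mathfrak S^{(\beta)}_{u(\tau)}(X;y_n,\dots,y_1)\,\mathfrak S^{(\beta)}_{v(\tau)}(X;Y)$ can be written as $$\Upsilon^{(\beta)}_\tau(X;Y)=\sum_{w\in S_n}c^{(\beta)}_{\tau,w}(Y)\,\mathfrak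 S^{(\beta)}_w(X;Y),$$ with coefficients $c^{(\beta)}_{\tau,w}(Y)$ in the localization of $\mathbb Z[\beta][Y]$ at the elements $1+\beta y_1,\dots,1+\beta y_n$. -/

import Mathlib

open MvPolynomial

noncomputable section

namespace BetaSchubert

/-! ### Polynomial rings -/

/-- The coefficient ring `ℤ[β][y₁,…,yₙ]`, where `ℤ[β]` is `Polynomial ℤ`. -/
abbrev YRing (n : ℕ) : Type := MvPolynomial (Fin n) (Polynomial ℤ)

/-- The ring `ℤ[β][Y][x₁,…,xₙ]`; the coefficient `c_κ(Y)` of `x^κ` in `f` is `MvPolynomial.coeff κ f`. -/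
abbrev XRing (n : ℕ) : Type := MvPolynomial (Fin n) (YRing n)

/-- The deformation parameter `β` as an element of `ℤ[β][Y]`. -/
def beta (n : ℕ) : YRing n := C Polynomial.X

/-- The variable `y_j`. -/
def yVar {n : ℕ} (j : Fin n) : YRing n := X j

/-- The variable `x_i`. -/
def xVar {n : ℕ} (i : Fin n) : XRing n := X i

/-! ### Divided differences -/

/-- The action of the transposition `(a b)` on the variables `X`; it fixes `β` and `Y`. -/
def swapX {n : ℕ} (a b : Fin n) (f : XRing n) : XRing n := rename (Equiv.swap a b) f

theorem xVar_sub_dvd {n : ℕ} (a b : Fin n) (f : XRing n) :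
    xVar a - xVar b ∣ f - swapX a b f := by
  unfold swapX
  induction f using MvPolynomial.induction_on with
  | C r => simp
  | add f g hf hg =>
    have : f + g - rename (Equiv.swap a b) (f + g)
        = (f - rename (Equiv.swap a b) f) + (g - rename (Equiv.swap a b) g) := by
      rw [map_add]; ring
    rw [this]
    exact dvd_add hf hg
  | mul_X f c hf =>
    have hc : xVar a - xVar b ∣ (X c : XRing n) - X (Equiv.swap a b c) := by
      rcases eq_or_ne c a with rfl | h1
      · simp [xVar]
      · rcases eq_or_ne c b with rfl | h2
        · rw [Equiv.swap_apply_right]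
          exact ⟨-1, by unfold xVar; ring⟩
        · simp [Equiv.swap_apply_of_ne_of_ne h1 h2]
    have : f * X c - rename (Equiv.swap a b) (f * X c)
        = (f - rename (Equiv.swap a b) f) * X c
          + rename (Equiv.swap a b) f * ((X c : XRing n) - X (Equiv.swap a b c)) := by
      rw [map_mul, rename_X]; ring
    rw [this]
    exact dvd_add (hf.mul_right _) (hc.mul_left _)

/-- The divided difference `(f - f^{(a b)}) / (x_a - x_b)` (used with `b = a + 1`): the exact quotient,
which exists by `xVar_sub_dvd` and is unique for `a ≠ b` since `XRing n` is a domain. -/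
def dividedDiff {n : ℕ} (a b : Fin n) (f : XRing n) : XRing n :=
  (xVar_sub_dvd a b f).choose

theorem dividedDiff_spec {n : ℕ} (a b : Fin n) (f : XRing n) :
    (xVar a - xVar b) * dividedDiff a b f = f - swapX a b f :=
  (xVar_sub_dvd a b f).choose_spec.symm

/-- `∂^{(β)} f = ∂ ((1 - β x_b) f)`, for the adjacent positions `a` and `b = a + 1`. -/
def betaDiff {n : ℕ} (a b : Fin n) (f : XRing n) : XRing n :=
  dividedDiff a b ((1 - C (beta n) * xVar b) * f)

/-! ### β-double Schubert polynomials -/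

/-- `a`, `b = a + 1` are adjacent positions with `w(a) < w(b)`. -/
def IsAscent {n : ℕ} (w : Equiv.Perm (Fin n)) (a b : Fin n) : Prop :=
  (b : ℕ) = a + 1 ∧ w a < w b

/-- `∏_{i=1}^{n-1} ∏_{j=1}^{n-i} (x_i - y_j + β x_i y_j)`. With indices starting from `0` the range
is `i + j + 2 ≤ n`. -/
def topPoly (n : ℕ) : XRing n :=
  ∏ i : Fin n, ∏ j ∈ Finset.univ.filter (fun j : Fin n => (i : ℕ) + j + 2 ≤ n),
    (xVar i - C (yVar j) + C (beta n) * xVar i * C (yVar j))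

theorem measure_decreases {n : ℕ} (w : Equiv.Perm (Fin n)) (a b : Fin n) (h : IsAscent w a b) :
    ∑ k : Fin n, (k : ℕ) * ((w * Equiv.swap a b) k : ℕ) < ∑ k : Fin n, (k : ℕ) * (w k : ℕ) := by
  obtain ⟨hab, hlt⟩ := h
  have hne : a ≠ b := by rintro rfl; omega
  have hb : b ∈ Finset.univ.erase a := Finset.mem_erase.2 ⟨hne.symm, Finset.mem_univ _⟩
  rw [← Finset.add_sum_erase _ _ (Finset.mem_univ a), ← Finset.add_sum_erase _ _ hb,
    ← Finset.add_sum_erase (a := a) _ (fun k : Fin n => (k : ℕ) * (w k : ℕ)) (Finset.mem_univ a),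
    ← Finset.add_sum_erase _ (fun k : Fin n => (k : ℕ) * (w k : ℕ)) hb]
  have hrest : ∑ k ∈ (Finset.univ.erase a).erase b, (k : ℕ) * ((w * Equiv.swap a b) k : ℕ)
      = ∑ k ∈ (Finset.univ.erase a).erase b, (k : ℕ) * (w k : ℕ) := by
    refine Finset.sum_congr rfl fun k hk => ?_
    simp only [Finset.mem_erase, Finset.mem_univ, and_true] at hk
    simp [Equiv.swap_apply_of_ne_of_ne hk.2 hk.1]
  rw [hrest]
  simp only [Equiv.Perm.coe_mul, Function.comp_apply, Equiv.swap_apply_left,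
    Equiv.swap_apply_right]
  have hlt' : (w a : ℕ) < w b := hlt
  rw [hab]
  nlinarith

/-- The β-double Schubert polynomial `𝔖^{(β)}_w(X;Y)`: it is `topPoly n` for the longest permutation
(the one without ascents), and `𝔖_w = ∂^{(β)}_i 𝔖_{w s_i}` if `w(i) < w(i+1)`. The definition picks
some ascent `i`; by `betaSchubert_eq_betaDiff` below the recursion then holds at every ascent. -/
def betaSchubert {n : ℕ} (w : Equiv.Perm (Fin n)) : XRing n :=
  open Classical in
  if h : ∃ ab : Fin n × Fin n, IsAscent w ab.1 ab.2 then
    betaDiff h.choose.1 h.choose.2 (betaSchubert (w * Equiv.swap h.choose.1 h.choose.2))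
  else topPoly n
termination_by ∑ k : Fin n, (k : ℕ) * (w k : ℕ)
decreasing_by exact measure_decreases w _ _ h.choose_spec

theorem betaSchubert_revPerm (n : ℕ) : betaSchubert (Fin.revPerm : Equiv.Perm (Fin n)) = topPoly n := by
  rw [betaSchubert, dif_neg]
  rintro ⟨⟨a, b⟩, hab, hlt⟩
  simp only [Fin.revPerm_apply, Fin.rev_lt_rev] at hlt hab
  have : (b : ℕ) < a := hlt
  omega

theorem swapX_add {n : ℕ} (a b : Fin n) (f g : XRing n) :
    swapX a b (f + g) = swapX a b f + swapX a b g := map_add _ f g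

theorem swapX_sub {n : ℕ} (a b : Fin n) (f g : XRing n) :
    swapX a b (f - g) = swapX a b f - swapX a b g :=
  map_sub (rename (Equiv.swap a b)) f g

theorem swapX_mul {n : ℕ} (a b : Fin n) (f g : XRing n) :
    swapX a b (f * g) = swapX a b f * swapX a b g := map_mul _ f g

theorem swapX_one {n : ℕ} (a b : Fin n) : swapX a b (1 : XRing n) = 1 := map_one _

theorem swapX_C {n : ℕ} (a b : Fin n) (r : YRing n) : swapX a b (C r : XRing n) = C r := by
  simp [swapX]

theorem swapX_left {n : ℕ} (a b : Fin n) : swapX a b (xVar a) = xVar b := by simp [swapX, xVar]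

theorem swapX_right {n : ℕ} (a b : Fin n) : swapX a b (xVar b) = xVar a := by simp [swapX, xVar]

theorem swapX_other {n : ℕ} {a b c : Fin n} (h1 : c ≠ a) (h2 : c ≠ b) :
    swapX a b (xVar c) = xVar c := by
  simp [swapX, xVar, Equiv.swap_apply_of_ne_of_ne h1 h2]

theorem swapX_swapX {n : ℕ} (a b : Fin n) (f : XRing n) : swapX a b (swapX a b f) = f := by
  simp only [swapX, rename_rename, ← Equiv.Perm.coe_mul, Equiv.swap_mul_self, Equiv.Perm.coe_one,
    rename_id, AlgHom.id_apply]

theorem swapX_comm {n : ℕ} {a b c d : Fin n} (hac : a ≠ c) (had : a ≠ d) (hbc : b ≠ c)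
    (hbd : b ≠ d) (f : XRing n) : swapX a b (swapX c d f) = swapX c d (swapX a b f) := by
  have h : Equiv.swap a b * Equiv.swap c d = Equiv.swap c d * Equiv.swap a b := by
    ext k
    simp only [Equiv.Perm.coe_mul, Function.comp_apply, Equiv.swap_apply_def]
    grind
  simp only [swapX, rename_rename, ← Equiv.Perm.coe_mul, h]

theorem swap_braid {n : ℕ} {a b d : Fin n} (hab : a ≠ b) (had : a ≠ d) (hbd : b ≠ d) :
    Equiv.swap a b * Equiv.swap b d * Equiv.swap a b
      = Equiv.swap b d * Equiv.swap a b * Equiv.swap b d := by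
  ext k
  simp only [Equiv.Perm.coe_mul, Function.comp_apply, Equiv.swap_apply_def]
  grind

theorem swapX_braid {n : ℕ} {a b d : Fin n} (hab : a ≠ b) (had : a ≠ d) (hbd : b ≠ d)
    (f : XRing n) :
    swapX a b (swapX b d (swapX a b f)) = swapX b d (swapX a b (swapX b d f)) := by
  have h := swap_braid hab had hbd
  simp only [swapX, rename_rename, ← Equiv.Perm.coe_mul, ← mul_assoc, h]

theorem xVar_sub_ne_zero {n : ℕ} {a b : Fin n} (h : a ≠ b) : (xVar a - xVar b : XRing n) ≠ 0 := by
  intro h0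
  exact h (X_injective (sub_eq_zero.1 h0))

theorem betaDiff_spec {n : ℕ} (a b : Fin n) (f : XRing n) :
    (xVar a - xVar b) * betaDiff a b f
      = (1 - C (beta n) * xVar b) * f - (1 - C (beta n) * xVar a) * swapX a b f := by
  rw [betaDiff, dividedDiff_spec, swapX_mul, swapX_sub, swapX_mul, swapX_one, swapX_C, swapX_right]

theorem swapX_betaDiff {n : ℕ} {a b : Fin n} (h : a ≠ b) (f : XRing n) :
    swapX a b (betaDiff a b f) = betaDiff a b f := by
  have h1 := betaDiff_spec a b f
  have h2 := congrArg (swapX a b) h1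
  simp only [swapX_mul, swapX_sub, swapX_one, swapX_C, swapX_left, swapX_right, swapX_swapX] at h2
  apply mul_left_cancel₀ (xVar_sub_ne_zero h)
  linear_combination -h2 - h1

theorem betaDiff_comm {n : ℕ} {a b c d : Fin n} (hab : a ≠ b) (hcd : c ≠ d) (hac : a ≠ c)
    (had : a ≠ d) (hbc : b ≠ c) (hbd : b ≠ d) (f : XRing n) :
    betaDiff a b (betaDiff c d f) = betaDiff c d (betaDiff a b f) := by
  have h1 := betaDiff_spec a b (betaDiff c d f)
  have h2 := betaDiff_spec c d f
  have h3 := congrArg (swapX a b) h2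
  have k1 := betaDiff_spec c d (betaDiff a b f)
  have k2 := betaDiff_spec a b f
  have k3 := congrArg (swapX c d) k2
  simp only [swapX_mul, swapX_sub, swapX_one, swapX_C, swapX_other hac.symm hbc.symm,
    swapX_other had.symm hbd.symm] at h3
  simp only [swapX_mul, swapX_sub, swapX_one, swapX_C, swapX_other hac had,
    swapX_other hbc hbd] at k3
  rw [← swapX_comm hac had hbc hbd] at k3
  apply mul_left_cancel₀ (mul_ne_zero (xVar_sub_ne_zero hab) (xVar_sub_ne_zero hcd))
  linear_combination (xVar c - xVar d) * h1 + (1 - C (beta n) * xVar b) * h2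
    - (1 - C (beta n) * xVar a) * h3 - (xVar a - xVar b) * k1 - (1 - C (beta n) * xVar d) * k2
    + (1 - C (beta n) * xVar c) * k3

theorem betaDiff_braid {n : ℕ} {a b d : Fin n} (hab : a ≠ b) (had : a ≠ d) (hbd : b ≠ d)
    (f : XRing n) :
    betaDiff a b (betaDiff b d (betaDiff a b f)) = betaDiff b d (betaDiff a b (betaDiff b d f)) := by
  set A := betaDiff a b f with hA
  set B := betaDiff b d A with hB
  set A' := betaDiff b d f with hA'
  set B' := betaDiff a b A' with hB'
  have sA : swapX a b A = A := swapX_betaDiff hab f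
  have sA' : swapX b d A' = A' := swapX_betaDiff hbd f
  have e1 := betaDiff_spec a b B
  have e2 : _ = _ := betaDiff_spec b d A
  have e3 := congrArg (swapX a b) e2
  have e4 : _ = _ := betaDiff_spec a b f
  have e5 := congrArg (swapX b d) e4
  have e6 := congrArg (swapX a b) e5
  have e1' := betaDiff_spec b d B'
  have e2' : _ = _ := betaDiff_spec a b A'
  have e3' := congrArg (swapX b d) e2'
  have e4' : _ = _ := betaDiff_spec b d f
  have e5' := congrArg (swapX a b) e4'
  have e6' := congrArg (swapX b d) e5'
  rw [← hA] at e4 e5 e6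
  rw [← hB] at e2 e3
  rw [← hA'] at e4' e5' e6'
  rw [← hB'] at e2' e3'
  have hd := swapX_other (n := n) had.symm hbd.symm
  have ha := swapX_other (n := n) hab had
  simp only [swapX_mul, swapX_sub, swapX_one, swapX_C, swapX_left, swapX_right, hd, ha,
    sA] at e3 e5 e6
  simp only [swapX_mul, swapX_sub, swapX_one, swapX_C, swapX_left, swapX_right, hd, ha,
    sA'] at e3' e5' e6'
  rw [swapX_braid hab had hbd] at e6
  apply mul_left_cancel₀ (mul_ne_zero (mul_ne_zero (xVar_sub_ne_zero hab) (xVar_sub_ne_zero had))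
    (xVar_sub_ne_zero hbd))
  generalize C (beta n) = t at *
  linear_combination (xVar a - xVar d) * (xVar b - xVar d) * e1
    + (xVar a - xVar d) * (1 - t * xVar b) * e2 - (xVar b - xVar d) * (1 - t * xVar a) * e3
    + (1 - t * xVar d) ^ 2 * e4 - (1 - t * xVar b) ^ 2 * e5 + (1 - t * xVar a) ^ 2 * e6
    - (xVar a - xVar d) * (xVar a - xVar b) * e1'
    - (xVar a - xVar d) * (1 - t * xVar d) * e2' + (xVar a - xVar b) * (1 - t * xVar b) * e3'
    - (1 - t * xVar d) * (1 - t * xVar b) * e4' + (1 - t * xVar d) * (1 - t * xVar a) * e5'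
    - (1 - t * xVar b) * (1 - t * xVar a) * e6'

theorem betaDiff_eq_of_lt {n : ℕ} (w : Equiv.Perm (Fin n))
    (ih : ∀ (v : Equiv.Perm (Fin n)),
      ∑ k : Fin n, (k : ℕ) * (v k : ℕ) < ∑ k : Fin n, (k : ℕ) * (w k : ℕ) →
      ∀ a b : Fin n, IsAscent v a b →
        betaSchubert v = betaDiff a b (betaSchubert (v * Equiv.swap a b)))
    {a b c d : Fin n} (hab : IsAscent w a b) (hcd : IsAscent w c d) (hac : a < c) :
    betaDiff a b (betaSchubert (w * Equiv.swap a b))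
      = betaDiff c d (betaSchubert (w * Equiv.swap c d)) := by
  have m1 := measure_decreases w a b hab
  have m2 := measure_decreases w c d hcd
  obtain ⟨eab, lab⟩ := hab
  obtain ⟨ecd, lcd⟩ := hcd
  have hac' : (a : ℕ) < c := hac
  have nab : a ≠ b := by rintro rfl; omega
  have ncd : c ≠ d := by rintro rfl; omega
  have nac : a ≠ c := by rintro rfl; omega
  have nad : a ≠ d := by rintro rfl; omega
  have nbd : b ≠ d := by rintro rfl; omega
  by_cases hbc : b = c
  · subst hbc
    have a1 : IsAscent (w * Equiv.swap a b) b d := by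
      refine ⟨ecd, ?_⟩
      simpa [Equiv.swap_apply_of_ne_of_ne nad.symm nbd.symm] using lab.trans lcd
    have a2 : IsAscent (w * Equiv.swap a b * Equiv.swap b d) a b := by
      refine ⟨eab, ?_⟩
      simpa [Equiv.swap_apply_of_ne_of_ne nad.symm nbd.symm,
        Equiv.swap_apply_of_ne_of_ne nab nad] using lcd
    have b1 : IsAscent (w * Equiv.swap b d) a b := by
      refine ⟨eab, ?_⟩
      simpa [Equiv.swap_apply_of_ne_of_ne nab nad] using lab.trans lcd
    have b2 : IsAscent (w * Equiv.swap b d * Equiv.swap a b) b d := by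
      refine ⟨ecd, ?_⟩
      simpa [Equiv.swap_apply_of_ne_of_ne nad.symm nbd.symm,
        Equiv.swap_apply_of_ne_of_ne nab nad] using lab
    rw [ih _ m1 b d a1, ih _ ((measure_decreases _ _ _ a1).trans m1) a b a2,
      ih _ m2 a b b1, ih _ ((measure_decreases _ _ _ b1).trans m2) b d b2,
      betaDiff_braid nab nad nbd]
    have h := swap_braid nab nad nbd
    rw [mul_assoc (w * _), mul_assoc w, ← mul_assoc (Equiv.swap a b), h]
    simp only [mul_assoc]
  · have a1 : IsAscent (w * Equiv.swap a b) c d := by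
      refine ⟨ecd, ?_⟩
      simpa [Equiv.swap_apply_of_ne_of_ne nac.symm (Ne.symm hbc),
        Equiv.swap_apply_of_ne_of_ne nad.symm nbd.symm] using lcd
    have b1 : IsAscent (w * Equiv.swap c d) a b := by
      refine ⟨eab, ?_⟩
      simpa [Equiv.swap_apply_of_ne_of_ne nac nad,
        Equiv.swap_apply_of_ne_of_ne hbc nbd] using lab
    have h : Equiv.swap a b * Equiv.swap c d = Equiv.swap c d * Equiv.swap a b := by
      ext k
      simp only [Equiv.Perm.coe_mul, Function.comp_apply, Equiv.swap_apply_def]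
      grind
    rw [ih _ m1 c d a1, ih _ m2 a b b1, betaDiff_comm nab ncd nac nad hbc nbd, mul_assoc, h,
      mul_assoc]

/-- The recursion holds at every ascent, so `betaSchubert` does not depend on any choice. -/
theorem betaSchubert_eq_betaDiff {n : ℕ} (w : Equiv.Perm (Fin n)) (a b : Fin n)
    (h : IsAscent w a b) :
    betaSchubert w = betaDiff a b (betaSchubert (w * Equiv.swap a b)) := by
  have hex : ∃ ab : Fin n × Fin n, IsAscent w ab.1 ab.2 := ⟨(a, b), h⟩
  obtain ⟨c, d, hcd, he⟩ : ∃ c d : Fin n, IsAscent w c d ∧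
      betaSchubert w = betaDiff c d (betaSchubert (w * Equiv.swap c d)) :=
    ⟨hex.choose.1, hex.choose.2, hex.choose_spec, by rw [betaSchubert, dif_pos hex]⟩
  have ih : ∀ (v : Equiv.Perm (Fin n)),
      ∑ k : Fin n, (k : ℕ) * (v k : ℕ) < ∑ k : Fin n, (k : ℕ) * (w k : ℕ) →
      ∀ a b : Fin n, IsAscent v a b →
        betaSchubert v = betaDiff a b (betaSchubert (v * Equiv.swap a b)) :=
    fun v _ a b hv => betaSchubert_eq_betaDiff v a b hv
  rw [he]
  rcases lt_trichotomy a c with hlt | rfl | hlt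
  · exact (betaDiff_eq_of_lt w ih h hcd hlt).symm
  · have : b = d := Fin.ext (h.1.trans hcd.1.symm)
    rw [this]
  · exact betaDiff_eq_of_lt w ih hcd h hlt
termination_by ∑ k : Fin n, (k : ℕ) * (w k : ℕ)

/-- Reversal of the `Y`-variables: `f(X;Y) ↦ f(X; yₙ, yₙ₋₁, …, y₁)`. -/
def reverseY {n : ℕ} (f : XRing n) : XRing n :=
  MvPolynomial.map (rename Fin.rev : YRing n →ₐ[Polynomial ℤ] YRing n).toRingHom f

end BetaSchubert

open BetaSchubert

/-! ### Clans -/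

/-- A `(p,q)`-clan: a partial matching of the `p + q` vertices, given by the involution `mate` whose
fixed points are the unpaired vertices, in which every unpaired vertex carries a sign (`plus` is the
set of those with sign `+`, the other unpaired vertices have sign `-`) and the number of `+`'s minus
the number of `-`'s is `p - q`. -/
structure Clan (p q : ℕ) where
  mate : Fin (p + q) → Fin (p + q)
  mate_mate : ∀ i, mate (mate i) = i
  plus : Finset (Fin (p + q))
  mate_of_mem_plus : ∀ i ∈ plus, mate i = i
  card_sub_card : (plus.card : ℤ)
    - ((Finset.univ.filter fun i => mate i = i ∧ i ∉ plus).card : ℤ) = (p : ℤ) - q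

namespace Clan

variable {p q : ℕ}

/-- Vertex `i` carries a `+`. -/
def IsPlus (γ : Clan p q) (i : Fin (p + q)) : Prop := i ∈ γ.plus

/-- Vertex `i` carries a `-`. -/
def IsMinus (γ : Clan p q) (i : Fin (p + q)) : Prop := γ.mate i = i ∧ i ∉ γ.plus

/-- Vertex `i` is the left end of an arc. -/
def IsLeftEnd (γ : Clan p q) (i : Fin (p + q)) : Prop := i < γ.mate i

/-- No two arcs `{a, c}` and `{b, d}` cross, `a < b < c < d`. -/
def NonCrossing (γ : Clan p q) : Prop :=
  ¬ ∃ a b c d : Fin (p + q), a < b ∧ b < c ∧ c < d ∧ γ.mate a = c ∧ γ.mate b = d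

/-- A clan without arcs. -/
def Matchless (γ : Clan p q) : Prop := ∀ i, γ.mate i = i

end Clan

/-- The map that gives the elements of `L` the labels `0, 1, …, |L| - 1` from left to right, and the
remaining vertices the labels `|L|, …, n - 1` from left to right. -/
def labelFun {n : ℕ} (L : Finset (Fin n)) (i : Fin n) : ℕ :=
  if i ∈ L then (L.filter (· < i)).card else L.card + (Lᶜ.filter (· < i)).card

theorem labelFun_lt {n : ℕ} (L : Finset (Fin n)) (i : Fin n) : labelFun L i < n := by
  have hc : L.card + Lᶜ.card = n := by simp
  unfold labelFun
  split_ifs with h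
  · have : (L.filter (· < i)).card < L.card :=
      Finset.card_lt_card (Finset.filter_ssubset.2 ⟨i, h, lt_irrefl i⟩)
    omega
  · have : (Lᶜ.filter (· < i)).card < Lᶜ.card :=
      Finset.card_lt_card (Finset.filter_ssubset.2 ⟨i, Finset.mem_compl.2 h, lt_irrefl i⟩)
    omega

theorem card_filter_lt_inj {n : ℕ} (L : Finset (Fin n)) {i j : Fin n} (hi : i ∈ L) (hj : j ∈ L)
    (h : (L.filter (· < i)).card = (L.filter (· < j)).card) : i = j := by
  by_contra hne
  wlog hlt : i < j generalizing i j
  · exact this hj hi h.symm (Ne.symm hne) (lt_of_le_of_ne (not_lt.1 hlt) (Ne.symm hne))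
  refine absurd h (ne_of_lt (Finset.card_lt_card ?_))
  rw [Finset.ssubset_iff_of_subset]
  · exact ⟨i, by simp [hi, hlt], by simp⟩
  · intro k hk
    simp only [Finset.mem_filter] at hk ⊢
    exact ⟨hk.1, hk.2.trans hlt⟩

theorem labelFun_injective {n : ℕ} (L : Finset (Fin n)) : Function.Injective (labelFun L) := by
  have key : ∀ i ∈ L, (L.filter (· < i)).card < L.card := fun i h =>
    Finset.card_lt_card (Finset.filter_ssubset.2 ⟨i, h, lt_irrefl i⟩)
  intro i j h
  unfold labelFun at h
  split_ifs at h with hi hj hj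
  · exact card_filter_lt_inj L hi hj h
  · have := key i hi
    omega
  · have := key j hj
    omega
  · exact card_filter_lt_inj Lᶜ (Finset.mem_compl.2 hi) (Finset.mem_compl.2 hj) (by omega)

/-- The labelling `labelFun L` as a permutation, in one-line notation `i ↦ label of vertex i`. -/
def labelPerm {n : ℕ} (L : Finset (Fin n)) : Equiv.Perm (Fin n) :=
  Equiv.ofBijective (fun i => ⟨labelFun L i, labelFun_lt L i⟩)
    (Finite.injective_iff_bijective.1 fun _ _ h =>
      labelFun_injective L (congrArg Fin.val h))

namespace Clan

variable {p q : ℕ}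

open Classical in
/-- The `-`'s and the left ends of arcs. -/
def lowU (γ : Clan p q) : Finset (Fin (p + q)) :=
  Finset.univ.filter fun i => γ.IsMinus i ∨ γ.IsLeftEnd i

open Classical in
/-- The `+`'s and the left ends of arcs. -/
def lowV (γ : Clan p q) : Finset (Fin (p + q)) :=
  Finset.univ.filter fun i => γ.IsPlus i ∨ γ.IsLeftEnd i

/-- `u(γ)`: the `-`'s and left ends of arcs get the labels `1, …, q` from left to right, the `+`'s
and right ends of arcs the labels `q + 1, …, n` (here shifted to start from `0`; there are `q`
vertices of the first kind by `card_lowU_lowV`). -/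
def u (γ : Clan p q) : Equiv.Perm (Fin (p + q)) := labelPerm γ.lowU

/-- `v(γ)`: the `+`'s and left ends of arcs get the labels `1, …, p` from left to right, the `-`'s
and right ends of arcs the labels `p + 1, …, n` (shifted to start from `0`; there are `p` vertices of the
first kind). -/
def v (γ : Clan p q) : Equiv.Perm (Fin (p + q)) := labelPerm γ.lowV

theorem card_lowU_lowV (γ : Clan p q) : γ.lowU.card = q ∧ γ.lowV.card = p := by
  classical
  set M : Finset (Fin (p + q)) := Finset.univ.filter fun i => γ.mate i = i ∧ i ∉ γ.plus with hM
  set Lf : Finset (Fin (p + q)) := Finset.univ.filter fun i => i < γ.mate i with hL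
  set Rt : Finset (Fin (p + q)) := Finset.univ.filter fun i => γ.mate i < i with hR
  have hLR : Lf.card = Rt.card := by
    refine Finset.card_bij (fun i _ => γ.mate i) ?_ ?_ ?_
    · intro i hi
      simpa [hL, hR, γ.mate_mate] using hi
    · intro i _ j _ h
      rw [← γ.mate_mate i, h, γ.mate_mate]
    · intro i hi
      exact ⟨γ.mate i, by simpa [hL, hR, γ.mate_mate] using hi, γ.mate_mate i⟩
  have hU : γ.lowU.card = M.card + Lf.card := by
    rw [← Finset.card_union_of_disjoint]
    · congr 1
      ext i
      rw [lowU, Finset.mem_filter]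
      simp [hM, hL, IsMinus, IsLeftEnd]
    · rw [Finset.disjoint_left]
      intro i hi hj
      simp only [hM, hL, Finset.mem_filter, Finset.mem_univ, true_and] at hi hj
      exact absurd hi.1 hj.ne'
  have hV : γ.lowV.card = γ.plus.card + Lf.card := by
    rw [← Finset.card_union_of_disjoint]
    · congr 1
      ext i
      rw [lowV, Finset.mem_filter]
      simp [hL, IsPlus, IsLeftEnd]
    · rw [Finset.disjoint_left]
      intro i hi hj
      simp only [hL, Finset.mem_filter, Finset.mem_univ, true_and] at hj
      exact absurd (γ.mate_of_mem_plus i hi) hj.ne'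
  have hUc : γ.lowUᶜ.card = γ.plus.card + Rt.card := by
    rw [← Finset.card_union_of_disjoint]
    · congr 1
      ext i
      have := γ.mate_of_mem_plus i
      simp only [lowU, hR, IsMinus, IsLeftEnd, Finset.mem_compl, Finset.mem_filter,
        Finset.mem_univ, true_and, Finset.mem_union]
      rcases lt_trichotomy i (γ.mate i) with h | h | h
      · have h1 := h.ne'
        have h2 := h.le
        grind
      · grind
      · have h1 := h.ne
        have h2 := h.le
        grind
    · rw [Finset.disjoint_left]
      intro i hi hj
      simp only [hR, Finset.mem_filter, Finset.mem_univ, true_and] at hj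
      exact absurd (γ.mate_of_mem_plus i hi) hj.ne
  have hc : γ.lowU.card + γ.lowUᶜ.card = p + q := by simp
  have hs := γ.card_sub_card
  rw [← hM] at hs
  omega

/-- The product `𝔖^{(β)}_{u(γ)}(X; yₙ, …, y₁) · 𝔖^{(β)}_{v(γ)}(X; Y)`. -/
def schubertProduct (γ : Clan p q) : XRing (p + q) :=
  reverseY (betaSchubert γ.u) * betaSchubert γ.v

/-- The initial polynomial `Υ^{(β)}_τ(X;Y)` of a matchless clan `τ`. -/
def upsilon (τ : Clan p q) (_ : τ.Matchless) : XRing (p + q) := τ.schubertProduct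

end Clan

/-! ### Coefficients of the expansion -/

/-- The localization of `ℤ[β][y₁,…,yₙ]` at the elements `1 + β y_j`. -/
abbrev LocYRing (n : ℕ) : Type :=
  Localization.Away (∏ j : Fin n, (1 + beta n * yVar j) : YRing n)

/-- A polynomial in `X` over `ℤ[β][Y]`, viewed as one over `LocYRing n`. -/
def toLoc {n : ℕ} (f : XRing n) : MvPolynomial (Fin n) (LocYRing n) :=
  MvPolynomial.map (algebraMap (YRing n) (LocYRing n)) f

end

namespace BetaSchubert

/-! ### Degrees in one variable -/

/-! Part (1) is a bound on the degree in each variable separately. The degree of $\mathfrak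
S^{(\beta)}_w$ in $x_c$ is at most the number of positions $e>c$ that are not left-to-right maxima
of the word $w_c w_{c+1}\cdots$ (`degreeOf_betaSchubert_le`, by induction along the first ascent).
For the labelling attached to a set $L$, such positions lie in $L$. For `lowU` and `lowV` together,
positions right of $c$ are counted twice only at left ends of arcs, and the corresponding right
ends, also right of $c$, are not counted at all; so the two bounds sum to at most $n-1-c$
(`card_low_add_card_low_le`).

Part (2) follows because every polynomial below the staircase has an expansion. The polynomials that
enter the span of the $\mathfrak S^{(\beta)}_w$ after multiplication by a power of $\prod_j(1+\beta
y_j)$ form a submodule `satSpan`, which is stable under all $\partial^{(\beta)}_i$ and under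
division by each $1+\beta y_j$, and contains $\mathfrak S^{(\beta)}_{w_0}$. By `generates`, these
properties alone force it to contain everything below the staircase.

For `generates`, variables are freed one at a time, from the last to the first. To free $x_K$, the
factors $x_K-y_j+\beta x_Ky_j$ are removed one by one: a twisted Leibniz rule for
$\partial^{(\beta)}_K$ trades a product in $x_K$ for one in $x_{K+1}$ with one factor fewer, which
is the right number for that variable. Powers of $x_K$ then come from $(1+\beta
y_j)x_K=(x_K-y_j+\beta x_Ky_j)+y_j$, the only reason for inverting $1+\beta y_j$. -/

theorem degreeOf_one_sub_beta_le {n : ℕ} (b i : Fin n) :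
    degreeOf i (1 - C (beta n) * xVar b : XRing n) ≤ if i = b then 1 else 0 := by
  refine (degreeOf_sub_le _ _ _).trans ?_
  refine max_le (by simp) ((degreeOf_C_mul_le _ _ _).trans ?_)
  rw [xVar, degreeOf_X]

theorem degreeOf_linear_le {n : ℕ} (i : Fin n) (c r : YRing n) (k : Fin n) :
    degreeOf k (xVar i - C c + C r * xVar i * C c : XRing n) ≤ if k = i then 1 else 0 := by
  refine (degreeOf_add_le _ _ _).trans (max_le ((degreeOf_sub_le _ _ _).trans (max_le ?_ ?_)) ?_)
  · rw [xVar, degreeOf_X]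
  · simp
  · refine (degreeOf_mul_C_le _ _ _).trans ((degreeOf_C_mul_le _ _ _).trans ?_)
    rw [xVar, degreeOf_X]

theorem degreeOf_swapX {n : ℕ} (a b i : Fin n) (f : XRing n) :
    degreeOf i (swapX a b f) = degreeOf (Equiv.swap a b i) f := by
  conv_lhs => rw [← Equiv.swap_apply_self a b i]
  exact degreeOf_rename_of_injective (Equiv.swap a b).injective _

theorem degreeOf_xVar_sub {n : ℕ} {a b : Fin n} (h : a ≠ b) :
    degreeOf a (xVar a - xVar b : XRing n) = 1 := by
  rw [sub_eq_add_neg, degreeOf_add_eq_of_degreeOf_lt]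
  · simp [xVar]
  · simp [xVar, degreeOf_neg, degreeOf_X_of_ne h]

/-- The asymmetric hypotheses are what the numerator tolerates: $1-\beta x_b$ adds no degree in
$x_a$, whereas the swapped term has the $x_b$-degree of $f$ plus one from $1-\beta x_a$. Both reach
at most $D+1$, and the quotient by $x_a-x_b$ loses one. -/
theorem degreeOf_betaDiff_left_le {n : ℕ} {a b : Fin n} (h : a ≠ b) {f : XRing n} {D : ℕ}
    (ha : degreeOf a f ≤ D + 1) (hb : degreeOf b f ≤ D) : degreeOf a (betaDiff a b f) ≤ D := by
  by_cases h0 : betaDiff a b f = 0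
  · simp [h0]
  have h1 : degreeOf a ((xVar a - xVar b) * betaDiff a b f) ≤ D + 1 := by
    rw [betaDiff_spec]
    refine (degreeOf_sub_le _ _ _).trans (max_le ((degreeOf_mul_le _ _ _).trans ?_)
      ((degreeOf_mul_le _ _ _).trans ?_))
    · have := degreeOf_one_sub_beta_le b a
      rw [if_neg h] at this
      omega
    · have := degreeOf_one_sub_beta_le a a
      rw [if_pos rfl] at this
      rw [degreeOf_swapX, Equiv.swap_apply_left]
      omega
  -- Degrees in one variable add exactly, since the coefficients form a domain.
  rw [degreeOf_mul_eq (xVar_sub_ne_zero h) h0, degreeOf_xVar_sub h] at h1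
  omega

/-- The image of $\partial^{(\beta)}$ is symmetric in $x_a,x_b$, so the bound for $x_a$ carries
over. -/
theorem degreeOf_betaDiff_right_le {n : ℕ} {a b : Fin n} (h : a ≠ b) {f : XRing n} {D : ℕ}
    (ha : degreeOf a f ≤ D + 1) (hb : degreeOf b f ≤ D) : degreeOf b (betaDiff a b f) ≤ D := by
  rw [← swapX_betaDiff h, degreeOf_swapX, Equiv.swap_apply_right]
  exact degreeOf_betaDiff_left_le h ha hb

theorem degreeOf_betaDiff_other_le {n : ℕ} {a b c : Fin n} (h : a ≠ b) (hca : c ≠ a) (hcb : c ≠ b)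
    (f : XRing n) : degreeOf c (betaDiff a b f) ≤ degreeOf c f := by
  by_cases h0 : betaDiff a b f = 0
  · simp [h0]
  have h1 : degreeOf c ((xVar a - xVar b) * betaDiff a b f) ≤ degreeOf c f := by
    rw [betaDiff_spec]
    refine (degreeOf_sub_le _ _ _).trans (max_le ((degreeOf_mul_le _ _ _).trans ?_)
      ((degreeOf_mul_le _ _ _).trans ?_))
    · have := degreeOf_one_sub_beta_le b c
      rw [if_neg hcb] at this
      omega
    · have := degreeOf_one_sub_beta_le a c
      rw [if_neg hca] at this
      rw [degreeOf_swapX, Equiv.swap_apply_of_ne_of_ne hca hcb]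
      omega
  rw [degreeOf_mul_eq (xVar_sub_ne_zero h) h0] at h1
  omega

theorem degreeOf_topPoly_le (n : ℕ) (k : Fin n) : degreeOf k (topPoly n) ≤ n - 1 - (k : ℕ) := by
  have hcard : (Finset.univ.filter fun j : Fin n => (k : ℕ) + j + 2 ≤ n).card ≤ n - 1 - (k : ℕ) := by
    rw [← Finset.card_range (n - 1 - (k : ℕ))]
    refine Finset.card_le_card_of_injOn (fun j : Fin n => (j : ℕ)) ?_ (Fin.val_injective.injOn)
    intro j hj
    simp only [Finset.coe_filter, Finset.mem_univ, true_and, Set.mem_ofPred_eq, Finset.coe_range,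
      Set.mem_Iio] at hj ⊢
    omega
  refine (degreeOf_prod_le _ _ _).trans ?_
  rw [Finset.sum_eq_single k]
  · refine (degreeOf_prod_le _ _ _).trans ((Finset.sum_le_card_nsmul _ _ 1 ?_).trans ?_)
    · intro j _
      simpa using degreeOf_linear_le k (yVar j) (beta n) k
    · simpa using hcard
  · intro i _ hik
    refine Nat.le_zero.1 ((degreeOf_prod_le _ _ _).trans (Finset.sum_nonpos ?_))
    intro j _
    simpa [hik.symm] using degreeOf_linear_le i (yVar j) (beta n) k
  · simp

/-! ### A degree bound for β-double Schubert polynomials -/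

/-- The positions `e > c` whose value is smaller than one of the values in positions `c, …, e - 1`. -/
def nonRecords {n : ℕ} (w : Equiv.Perm (Fin n)) (c : Fin n) : Finset (Fin n) :=
  Finset.univ.filter fun e => c < e ∧ ∃ t, c ≤ t ∧ t < e ∧ w e < w t

theorem mem_nonRecords {n : ℕ} {w : Equiv.Perm (Fin n)} {c e : Fin n} :
    e ∈ nonRecords w c ↔ c < e ∧ ∃ t, c ≤ t ∧ t < e ∧ w e < w t := by
  simp [nonRecords]

theorem lt_of_forall_not_isAscent {n : ℕ} {w : Equiv.Perm (Fin n)} {m : Fin n}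
    (h : ∀ a b : Fin n, b ≤ m → ¬ IsAscent w a b) {c e : Fin n} (hce : c < e) (hem : e ≤ m) :
    w e < w c := by
  obtain ⟨e, he⟩ := e
  induction e with
  | zero => exact absurd hce (by simp [Fin.lt_def])
  | succ e ih =>
    have he' : e < n := by omega
    have h1 : w ⟨e + 1, he⟩ < w ⟨e, he'⟩ := by
      refine lt_of_le_of_ne (not_lt.1 fun hlt => h ⟨e, he'⟩ ⟨e + 1, he⟩ hem ⟨rfl, hlt⟩) ?_
      intro heq
      simpa using w.injective heq
    simp only [Fin.lt_def, Fin.le_def] at hce hem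
    rcases Nat.lt_succ_iff_lt_or_eq.1 hce with hlt | heq
    · exact h1.trans (ih he' hlt (by simp only [Fin.le_def]; omega))
    · have : c = ⟨e, he'⟩ := Fin.ext heq
      rwa [this]

/-! ### Effect of an adjacent swap on the number of non-records -/

section Ascent

variable {n : ℕ} {w : Equiv.Perm (Fin n)} {a b : Fin n}

/-- A window $[c,e)$ containing both $a$ and $b$ is preserved by the swap, so witnesses $t$ can be
transported. -/
theorem swap_mem_Ico {c e t : Fin n} (hab : (b : ℕ) = a + 1) (hca : c ≤ a) (hbe : b < e)
    (h1 : c ≤ t) (h2 : t < e) : c ≤ Equiv.swap a b t ∧ Equiv.swap a b t < e := by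
  simp only [Fin.lt_def, Fin.le_def] at *
  rw [Equiv.swap_apply_def]
  split_ifs with h3 h4
  · omega
  · omega
  · omega

theorem card_nonRecords_left_le (hab : (b : ℕ) = a + 1) :
    (nonRecords (w * Equiv.swap a b) a).card ≤ (nonRecords w a).card + 1 := by
  refine (Finset.card_le_card (t := insert b (nonRecords w a)) ?_).trans (Finset.card_insert_le _ _)
  intro e he
  obtain ⟨hae, t, hat, hte, hlt⟩ := mem_nonRecords.1 he
  rw [Finset.mem_insert, or_iff_not_imp_left]
  intro hne
  have hbe : b < e := by
    simp only [Fin.lt_def, Fin.ext_iff] at *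
    omega
  obtain ⟨h1, h2⟩ := swap_mem_Ico hab le_rfl hbe hat hte
  refine mem_nonRecords.2 ⟨hae, _, h1, h2, ?_⟩
  simpa [Equiv.swap_apply_of_ne_of_ne hae.ne' hbe.ne'] using hlt

theorem card_nonRecords_right_le (hab : (b : ℕ) = a + 1) :
    (nonRecords (w * Equiv.swap a b) b).card ≤ (nonRecords w a).card := by
  refine Finset.card_le_card fun e he => ?_
  obtain ⟨hbe, t, hbt, hte, hlt⟩ := mem_nonRecords.1 he
  have hlab : a < b := by simp only [Fin.lt_def]; omega
  have hae := hlab.trans hbe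
  obtain ⟨h1, h2⟩ := swap_mem_Ico hab le_rfl hbe (hlab.le.trans hbt) hte
  refine mem_nonRecords.2 ⟨hae, _, h1, h2, ?_⟩
  simpa [Equiv.swap_apply_of_ne_of_ne hae.ne' hbe.ne'] using hlt

/-- At an ascent $b$ is not a non-record for $a$, and a witness $t=a$ can be replaced by $b$, whose
value is larger. This lets the common bound for $x_a$ and $x_b$ after $\partial^{(\beta)}$ serve for
$x_b$. -/
theorem card_nonRecords_le_right (h : IsAscent w a b) :
    (nonRecords w a).card ≤ (nonRecords w b).card := by
  obtain ⟨hab, hw⟩ := h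
  refine Finset.card_le_card fun e he => ?_
  obtain ⟨hae, t, hat, hte, hlt⟩ := mem_nonRecords.1 he
  have hbe : b ≤ e := by simp only [Fin.lt_def, Fin.le_def] at *; omega
  rcases hat.eq_or_lt with rfl | hat'
  · have hne : b ≠ e := by rintro rfl; exact lt_asymm hw hlt
    exact mem_nonRecords.2 ⟨lt_of_le_of_ne hbe hne, b, le_rfl, lt_of_le_of_ne hbe hne, hlt.trans hw⟩
  · have hbt : b ≤ t := by simp only [Fin.lt_def, Fin.le_def] at *; omega
    exact mem_nonRecords.2 ⟨hbt.trans_lt hte, t, hbt, hte, hlt⟩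

/-- For $c<a$ the swap of $a$ and $b$ injects one set into the other; for $c>b$ nothing changes. The
hypothesis that $w_a$ lies below all earlier values, available at the first ascent, handles position
$b$, whose image $a$ must be a non-record of $w$. -/
theorem card_nonRecords_other_le (hab : (b : ℕ) = a + 1)
    (hdec : ∀ c, c < a → w a < w c) {c : Fin n} (hca : c ≠ a) (hcb : c ≠ b) :
    (nonRecords (w * Equiv.swap a b) c).card ≤ (nonRecords w c).card := by
  have hlab : a < b := by simp only [Fin.lt_def]; omega
  rcases lt_or_gt_of_ne hca with hlt | hgt
  · refine Finset.card_le_card_of_injOn (Equiv.swap a b) ?_ (Equiv.injective _).injOn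
    intro e he
    obtain ⟨hce, t, hct, hte, hw⟩ := mem_nonRecords.1 (Finset.mem_coe.1 he)
    refine Finset.mem_coe.2 (mem_nonRecords.2 ?_)
    rcases eq_or_ne e a with rfl | hea
    · rw [Equiv.swap_apply_left]
      refine ⟨hce.trans hlab, t, hct, hte.trans hlab, ?_⟩
      simpa [Equiv.swap_apply_of_ne_of_ne hte.ne (hte.trans hlab).ne] using hw
    rcases eq_or_ne e b with rfl | heb
    · rw [Equiv.swap_apply_right]
      -- The original witness may be $a$ itself, so $c$ is used as a fresh one.
      exact ⟨hlt, c, le_rfl, hlt, hdec c hlt⟩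
    rw [Equiv.swap_apply_of_ne_of_ne hea heb]
    rcases lt_or_gt_of_ne hea with h | h
    · refine ⟨hce, t, hct, hte, ?_⟩
      simpa [Equiv.swap_apply_of_ne_of_ne hea heb, Equiv.swap_apply_of_ne_of_ne (hte.trans h).ne
        (hte.trans (h.trans hlab)).ne] using hw
    · have hbe : b < e := by simp only [Fin.lt_def, Ne, Fin.ext_iff] at *; omega
      obtain ⟨h1, h2⟩ := swap_mem_Ico hab hlt.le hbe hct hte
      refine ⟨hce, _, h1, h2, ?_⟩
      simpa [Equiv.swap_apply_of_ne_of_ne hea heb] using hw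
  · refine Finset.card_le_card fun e he => ?_
    obtain ⟨hce, t, hct, hte, hw⟩ := mem_nonRecords.1 he
    have hbc : b < c := by simp only [Fin.lt_def, Ne, Fin.ext_iff] at *; omega
    refine mem_nonRecords.2 ⟨hce, t, hct, hte, ?_⟩
    simpa [Equiv.swap_apply_of_ne_of_ne (hgt.trans hce).ne' (hbc.trans hce).ne',
      Equiv.swap_apply_of_ne_of_ne (hgt.trans_le hct).ne' (hbc.trans_le hct).ne'] using hw

end Ascent

theorem exists_first_ascent {n : ℕ} {w : Equiv.Perm (Fin n)}
    (h : ∃ ab : Fin n × Fin n, IsAscent w ab.1 ab.2) :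
    ∃ a b, IsAscent w a b ∧ ∀ c, c < a → w a < w c := by
  classical
  obtain ⟨⟨a₀, b₀⟩, h₀⟩ := h
  obtain ⟨a, ⟨b, hab⟩, hmin⟩ := exists_minimal_of_wellFoundedLT
    (fun a : Fin n => ∃ b, IsAscent w a b) ⟨a₀, b₀, h₀⟩
  refine ⟨a, b, hab, fun c hc => lt_of_forall_not_isAscent (m := a) ?_ hc le_rfl⟩
  intro c e he hce
  have hlt : c < a := by
    have := hce.1
    simp only [Fin.lt_def, Fin.le_def] at *
    omega
  exact absurd (hmin ⟨e, hce⟩ hlt.le) (not_le.2 hlt)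

/-- Independence of the chosen ascent allows the recursion to run at the first one, where every
count behaves monotonically. With $D$ the count of $w$ at $a$, the polynomial of $ws_a$ has degree
at most $D+1$ in $x_a$ and $D$ in $x_b$, exactly what the divided difference needs. Without ascents
every later position is a non-record. -/
theorem degreeOf_betaSchubert_le {n : ℕ} (w : Equiv.Perm (Fin n)) (c : Fin n) :
    degreeOf c (betaSchubert w) ≤ (nonRecords w c).card := by
  by_cases h : ∃ ab : Fin n × Fin n, IsAscent w ab.1 ab.2
  · obtain ⟨a, b, hab, hdec⟩ := exists_first_ascent h
    have hne : a ≠ b := by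
      rintro rfl
      have := hab.1
      omega
    have ih := degreeOf_betaSchubert_le (w * Equiv.swap a b)
    have ha := (ih a).trans (card_nonRecords_left_le hab.1)
    have hb := (ih b).trans (card_nonRecords_right_le hab.1)
    rw [betaSchubert_eq_betaDiff w a b hab]
    rcases eq_or_ne c a with rfl | hca
    · exact degreeOf_betaDiff_left_le hne ha hb
    rcases eq_or_ne c b with rfl | hcb
    · exact (degreeOf_betaDiff_right_le hne ha hb).trans (card_nonRecords_le_right hab)
    · exact (degreeOf_betaDiff_other_le hne hca hcb _).trans
        ((ih c).trans (card_nonRecords_other_le hab.1 hdec hca hcb))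
  · rw [betaSchubert, dif_neg h]
    refine (degreeOf_topPoly_le n c).trans ?_
    have hsub : Finset.Ioi c ⊆ nonRecords w c := by
      intro e he
      rw [Finset.mem_Ioi] at he
      refine mem_nonRecords.2 ⟨he, c, le_rfl, he, lt_of_forall_not_isAscent (m := e) ?_ he le_rfl⟩
      exact fun a b _ hab => h ⟨(a, b), hab⟩
    simpa using Finset.card_le_card hsub
termination_by ∑ k : Fin n, (k : ℕ) * (w k : ℕ)
decreasing_by exact measure_decreases w _ _ hab

/-- Off $L$ the labels increase and exceed all labels on $L$, so a position off $L$ beats everything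
before it. -/
theorem nonRecords_labelPerm_subset {n : ℕ} (L : Finset (Fin n)) (c : Fin n) :
    nonRecords (labelPerm L) c ⊆ L.filter (c < ·) := by
  intro e he
  obtain ⟨hce, t, -, hte, hlt⟩ := mem_nonRecords.1 he
  refine Finset.mem_filter.2 ⟨by_contra fun heL => ?_, hce⟩
  have hlt' : labelFun L e < labelFun L t := hlt
  unfold labelFun at hlt'
  rw [if_neg heL] at hlt'
  split_ifs at hlt' with htL
  · have := Finset.card_le_card (Finset.filter_subset (· < t) L)
    omega
  · have : (Lᶜ.filter (· < t)).card ≤ (Lᶜ.filter (· < e)).card := by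
      refine Finset.card_le_card fun k hk => ?_
      rw [Finset.mem_filter] at hk ⊢
      exact ⟨hk.1, hk.2.trans hte⟩
    omega

theorem degreeOf_reverseY_le {n : ℕ} (f : XRing n) (c : Fin n) :
    degreeOf c (reverseY f) ≤ degreeOf c f := by
  rw [degreeOf_le_iff]
  exact fun m hm => monomial_le_degreeOf c (support_map_subset _ _ hm)

end BetaSchubert

/-! ### Counting the ends of arcs to the right of a vertex -/

namespace Clan

open BetaSchubert

/-- The two sets overlap only in left ends of arcs and both avoid right ends. Passing to the mate
injects left ends beyond $c$ into right ends beyond $c$, so the overlap is paid for by positions in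
neither set. -/
theorem card_low_add_card_low_le {p q : ℕ} (γ : Clan p q) (c : Fin (p + q)) :
    (γ.lowU.filter (c < ·)).card + (γ.lowV.filter (c < ·)).card ≤ p + q - 1 - (c : ℕ) := by
  classical
  set Lf : Finset (Fin (p + q)) := Finset.univ.filter fun i => c < i ∧ i < γ.mate i with hL
  set Rt : Finset (Fin (p + q)) := Finset.univ.filter fun i => c < i ∧ γ.mate i < i with hR
  have hLR : Lf.card ≤ Rt.card := by
    refine Finset.card_le_card_of_injOn γ.mate ?_ ?_
    · intro i hi
      simp only [hL, hR, Finset.coe_filter, Finset.mem_univ, true_and, Set.mem_ofPred_eq,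
        γ.mate_mate] at hi ⊢
      exact ⟨hi.1.trans hi.2, hi.2⟩
    · intro i _ j _ h
      rw [← γ.mate_mate i, h, γ.mate_mate]
  have hinter : γ.lowU.filter (c < ·) ∩ γ.lowV.filter (c < ·) ⊆ Lf := by
    intro i hi
    have := γ.mate_of_mem_plus i
    simp only [lowU, lowV, hL, IsMinus, IsPlus, IsLeftEnd, Finset.mem_inter, Finset.mem_filter,
      Finset.mem_univ, true_and] at hi ⊢
    grind
  have hdisj : Disjoint (γ.lowU.filter (c < ·) ∪ γ.lowV.filter (c < ·)) Rt := by
    rw [Finset.disjoint_left]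
    intro i hi hj
    have := γ.mate_of_mem_plus i
    simp only [lowU, lowV, hR, IsMinus, IsPlus, IsLeftEnd, Finset.mem_union, Finset.mem_filter,
      Finset.mem_univ, true_and] at hi hj
    have h1 := hj.2.ne
    have h2 := hj.2.le
    grind
  have hsub : (γ.lowU.filter (c < ·) ∪ γ.lowV.filter (c < ·)) ∪ Rt ⊆ Finset.Ioi c := by
    intro i hi
    simp only [hR, Finset.mem_union, Finset.mem_filter, Finset.mem_Ioi] at hi ⊢
    tauto
  have h1 := Finset.card_le_card hsub
  rw [Finset.card_union_of_disjoint hdisj, Fin.card_Ioi] at h1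
  have h2 := Finset.card_union_add_card_inter (γ.lowU.filter (c < ·)) (γ.lowV.filter (c < ·))
  have h3 := Finset.card_le_card hinter
  omega

theorem degreeOf_schubertProduct_le {p q : ℕ} (γ : Clan p q) (c : Fin (p + q)) :
    degreeOf c γ.schubertProduct ≤ p + q - 1 - (c : ℕ) := by
  refine (degreeOf_mul_le _ _ _).trans ((add_le_add ?_ ?_).trans (γ.card_low_add_card_low_le c))
  · exact (degreeOf_reverseY_le _ _).trans ((degreeOf_betaSchubert_le _ _).trans
      (Finset.card_le_card (nonRecords_labelPerm_subset _ _)))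
  · exact (degreeOf_betaSchubert_le _ _).trans
      (Finset.card_le_card (nonRecords_labelPerm_subset _ _))

end Clan

namespace BetaSchubert

/-! ### Linearity of the β-divided differences -/

theorem betaDiff_mul_of_symm {n : ℕ} {a b : Fin n} (h : a ≠ b) {s : XRing n}
    (hs : swapX a b s = s) (f : XRing n) : betaDiff a b (s * f) = s * betaDiff a b f := by
  apply mul_left_cancel₀ (xVar_sub_ne_zero h)
  have h1 := betaDiff_spec a b (s * f)
  have h2 := betaDiff_spec a b f
  rw [swapX_mul, hs] at h1
  linear_combination h1 - s * h2

theorem betaDiff_C_mul {n : ℕ} {a b : Fin n} (h : a ≠ b) (r : YRing n) (f : XRing n) :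
    betaDiff a b (C r * f) = C r * betaDiff a b f :=
  betaDiff_mul_of_symm h (swapX_C a b r) f

theorem betaDiff_add {n : ℕ} {a b : Fin n} (h : a ≠ b) (f g : XRing n) :
    betaDiff a b (f + g) = betaDiff a b f + betaDiff a b g := by
  apply mul_left_cancel₀ (xVar_sub_ne_zero h)
  have h1 := betaDiff_spec a b (f + g)
  rw [swapX_add] at h1
  linear_combination h1 - betaDiff_spec a b f - betaDiff_spec a b g

theorem betaDiff_of_symm {n : ℕ} {a b : Fin n} (h : a ≠ b) {s : XRing n}
    (hs : swapX a b s = s) : betaDiff a b s = C (beta n) * s := by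
  apply mul_left_cancel₀ (xVar_sub_ne_zero h)
  have h1 := betaDiff_spec a b s
  rw [hs] at h1
  linear_combination h1

/-- `∂^{(β)}` as a linear map over `ℤ[β][Y]`. -/
noncomputable def betaDiffLinear {n : ℕ} {a b : Fin n} (h : a ≠ b) :
    XRing n →ₗ[YRing n] XRing n where
  toFun := betaDiff a b
  map_add' := betaDiff_add h
  map_smul' r f := by simpa [MvPolynomial.smul_eq_C_mul] using betaDiff_C_mul h r f

/-! ### The linear factors -/

/-- `x_i - y_j + β x_i y_j`. -/
noncomputable def lin {n : ℕ} (i j : Fin n) : XRing n :=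
  xVar i - C (yVar j) + C (beta n) * xVar i * C (yVar j)

/-- `∏_{j ∈ A} (x_i - y_j + β x_i y_j)`. -/
noncomputable def prodLin {n : ℕ} (A : Finset (Fin n)) (i : Fin n) : XRing n := ∏ j ∈ A, lin i j

/-- `∏_{i ≥ k} ∏_{j ∈ J i} (x_i - y_j + β x_i y_j)`. -/
noncomputable def tailProd {n : ℕ} (J : Fin n → Finset (Fin n)) (k : ℕ) : XRing n :=
  ∏ i ∈ Finset.univ.filter (fun i : Fin n => k ≤ i), prodLin (J i) i

theorem swapX_prodLin_left {n : ℕ} (a b : Fin n) (A : Finset (Fin n)) :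
    swapX a b (prodLin A a) = prodLin A b := by
  simp only [swapX, prodLin, map_prod]
  refine Finset.prod_congr rfl fun j _ => ?_
  simp [lin, xVar]

theorem swapX_prodLin_right {n : ℕ} (a b : Fin n) (A : Finset (Fin n)) :
    swapX a b (prodLin A b) = prodLin A a := by
  rw [← swapX_prodLin_left a b, swapX_swapX]

theorem swapX_prodLin_other {n : ℕ} {a b i : Fin n} (ha : i ≠ a) (hb : i ≠ b)
    (A : Finset (Fin n)) : swapX a b (prodLin A i) = prodLin A i := by
  simp only [swapX, prodLin, map_prod]
  refine Finset.prod_congr rfl fun j _ => ?_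
  simp [lin, xVar, Equiv.swap_apply_of_ne_of_ne ha hb]

theorem swapX_tailProd {n : ℕ} {a b : Fin n} (J : Fin n → Finset (Fin n)) {k : ℕ}
    (ha : (a : ℕ) < k) (hb : (b : ℕ) < k) : swapX a b (tailProd J k) = tailProd J k := by
  unfold tailProd
  rw [swapX, map_prod]
  refine Finset.prod_congr rfl fun i hi => ?_
  have hi' := (Finset.mem_filter.1 hi).2
  exact swapX_prodLin_other (by rintro rfl; omega) (by rintro rfl; omega) _

theorem prodLin_insert {n : ℕ} {A : Finset (Fin n)} {j : Fin n} (hj : j ∉ A) (i : Fin n) :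
    prodLin (insert j A) i = lin i j * prodLin A i := Finset.prod_insert hj

theorem tailProd_eq_mul {n : ℕ} (J : Fin n → Finset (Fin n)) (i : Fin n) :
    tailProd J i = prodLin (J i) i * tailProd J (i + 1) := by
  unfold tailProd
  have h : Finset.univ.filter (fun e : Fin n => (i : ℕ) ≤ e)
      = insert i (Finset.univ.filter fun e : Fin n => (i : ℕ) + 1 ≤ e) := by
    ext e
    simp only [Finset.mem_filter, Finset.mem_univ, true_and, Finset.mem_insert, Fin.ext_iff]
    omega
  rw [h, Finset.prod_insert (by simp)]

theorem tailProd_congr {n : ℕ} {J J' : Fin n → Finset (Fin n)} {k : ℕ}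
    (h : ∀ i : Fin n, k ≤ i → J i = J' i) : tailProd J k = tailProd J' k :=
  Finset.prod_congr rfl fun i hi => by rw [h i (Finset.mem_filter.1 hi).2]

/-- A twisted Leibniz rule. The factor changes under the swap by $(x_a-x_b)(1+\beta y_j)$, and
$(1-\beta x_a)(1+\beta y_j)=1-\beta(x_a-y_j+\beta x_ay_j)$; hence the swapped $f$ appears with
coefficient $1$ modulo the linear factor. -/
theorem betaDiff_lin_mul {n : ℕ} {a b : Fin n} (h : a ≠ b) (j : Fin n) (f : XRing n) :
    betaDiff a b (lin a j * f)
      = swapX a b f + lin a j * (betaDiff a b f - C (beta n) * swapX a b f) := by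
  apply mul_left_cancel₀ (xVar_sub_ne_zero h)
  have h1 := betaDiff_spec a b (lin a j * f)
  have h2 := betaDiff_spec a b f
  have h3 : swapX a b (lin a j) = lin b j := by simp [swapX, lin, xVar]
  rw [swapX_mul, h3] at h1
  unfold lin at *
  linear_combination h1 - (xVar a - C (yVar j) + C (beta n) * xVar a * C (yVar j)) * h2

/-! ### Polynomials with bounded exponents -/

/-- All exponents of the variable `x_i` in `f` are at most `m i`. -/
def DegLE {n : ℕ} (m : Fin n → ℕ) (f : XRing n) : Prop := ∀ i, degreeOf i f ≤ m i

/-- The exponents `(0, …, 0, n - 1 - k, …, 1, 0)`. -/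
def staircase (n k : ℕ) (i : Fin n) : ℕ := if (i : ℕ) < k then 0 else n - 1 - i

theorem DegLE.mul {n : ℕ} {m m' : Fin n → ℕ} {f g : XRing n} (hf : DegLE m f) (hg : DegLE m' g) :
    DegLE (fun i => m i + m' i) (f * g) :=
  fun i => (degreeOf_mul_le _ _ _).trans (add_le_add (hf i) (hg i))

theorem DegLE.mono {n : ℕ} {m m' : Fin n → ℕ} {f : XRing n} (hf : DegLE m f) (h : ∀ i, m i ≤ m' i) :
    DegLE m' f := fun i => (hf i).trans (h i)

theorem degLE_X_pow {n : ℕ} (k : Fin n) (s : ℕ) :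
    DegLE (fun i => if i = k then s else 0) (xVar k ^ s : XRing n) := by
  intro i
  rcases eq_or_ne i k with rfl | h
  · simp [xVar]
  · simp [xVar, degreeOf_X_pow_of_ne s h]

theorem degLE_prodLin {n : ℕ} (A : Finset (Fin n)) (i : Fin n) :
    DegLE (fun k => if k = i then A.card else 0) (prodLin A i) := by
  intro k
  refine (degreeOf_prod_le _ _ _).trans ((Finset.sum_le_card_nsmul _ _ (if k = i then 1 else 0) ?_).trans ?_)
  · exact fun j _ => degreeOf_linear_le i (yVar j) (beta n) k
  · by_cases h : k = i <;> simp [h]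

theorem degLE_tailProd {n : ℕ} {J : Fin n → Finset (Fin n)} {k : ℕ}
    (hJ : ∀ i : Fin n, k ≤ i → (J i).card = n - 1 - (i : ℕ)) :
    DegLE (staircase n k) (tailProd J k) := by
  intro e
  refine (degreeOf_prod_le _ _ _).trans ((Finset.sum_le_sum fun i _ =>
    degLE_prodLin (J i) i e).trans ?_)
  rw [Finset.sum_ite_eq, staircase]
  by_cases h : (e : ℕ) < k
  · simp [h]
  · simp [h, not_lt.1 h, hJ e (not_lt.1 h)]

/-- Reduces membership to one power of $x_k$ at a time, by splitting $x_k$ off each monomial. -/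
theorem mem_of_degLE_update {n : ℕ} {S : Submodule (YRing n) (XRing n)} {k : Fin n} {e : ℕ}
    {m : Fin n → ℕ} (hm : m k = 0)
    (hS : ∀ s ≤ e, ∀ h, DegLE m h → xVar k ^ s * h ∈ S) {h : XRing n}
    (hh : DegLE (Function.update m k e) h) : h ∈ S := by
  rw [← support_sum_monomial_coeff h]
  refine Submodule.sum_mem _ fun κ hκ => ?_
  have hle : ∀ i, κ i ≤ Function.update m k e i := fun i => (monomial_le_degreeOf i hκ).trans (hh i)
  have hsplit : monomial κ (coeff κ h) = xVar k ^ κ k * monomial (κ.erase k) (coeff κ h) := by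
    rw [xVar, X_pow_eq_monomial, monomial_mul, one_mul, Finsupp.single_add_erase]
  rw [hsplit]
  refine hS _ (by simpa using hle k) _ fun i => ?_
  rw [degreeOf_le_iff]
  intro μ hμ
  rw [Finset.mem_singleton.1 (support_monomial_subset hμ)]
  rcases eq_or_ne i k with rfl | hik
  · simp
  · simpa [hik] using hle i

/-! ### Submodules stable under β-divided differences -/

/-- `N` is stable under `∂^{(β)}_i` for `i ≥ k` and under division by the elements `1 + β y_j`. -/
structure StableFrom {n : ℕ} (k : ℕ) (N : Submodule (YRing n) (XRing n)) : Prop where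
  betaDiff_mem : ∀ a b : Fin n, k ≤ a → (b : ℕ) = a + 1 → ∀ f ∈ N, betaDiff a b f ∈ N
  mem_of_mul : ∀ (j : Fin n) (f : XRing n), C (1 + beta n * yVar j) * f ∈ N → f ∈ N

/-- A factor in an earlier variable is fixed by the later swaps, so $\partial^{(\beta)}$ commutes
with it. The inductive hypothesis can thus be applied with that factor absorbed into the submodule.
-/
theorem StableFrom.comap_mul {n : ℕ} {k : ℕ} {N : Submodule (YRing n) (XRing n)}
    (hN : StableFrom k N) (i : Fin n) (hi : (i : ℕ) < k) (A : Finset (Fin n)) :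
    StableFrom k (N.comap (LinearMap.mulLeft (YRing n) (prodLin A i))) where
  betaDiff_mem a b ha hb f hf := by
    have h : prodLin A i * betaDiff a b f = betaDiff a b (prodLin A i * f) :=
      (betaDiff_mul_of_symm (by rintro rfl; omega) (swapX_prodLin_other
        (by rintro rfl; omega) (by rintro rfl; omega) A) f).symm
    simpa [h] using hN.betaDiff_mem a b ha hb _ hf
  mem_of_mul j f hf := by
    refine hN.mem_of_mul j _ ?_
    simpa [mul_left_comm] using hf

theorem StableFrom.succ {n : ℕ} {k : ℕ} {N : Submodule (YRing n) (XRing n)}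
    (hN : StableFrom k N) : StableFrom (k + 1) N :=
  ⟨fun a b ha => hN.betaDiff_mem a b (by omega), hN.mem_of_mul⟩

/-- Every submodule that is stable from `k` on and contains a product of `n - 1 - i` linear factors in
each `x_i`, `i ≥ k`, contains all polynomials in these variables below the staircase. -/
def Generates (n k : ℕ) : Prop :=
  ∀ (N : Submodule (YRing n) (XRing n)) (J : Fin n → Finset (Fin n)), StableFrom k N →
    (∀ i : Fin n, k ≤ i → (J i).card = n - 1 - (i : ℕ)) → tailProd J k ∈ N →
    ∀ h, DegLE (staircase n k) h → h ∈ N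

/-! ### Freeing one more variable -/

section Step

variable {n : ℕ} {K : Fin n} {N : Submodule (YRing n) (XRing n)} {J : Fin n → Finset (Fin n)}

theorem Generates.prodLin_mul_mem (hG : Generates n (K + 1)) (hN : StableFrom K N)
    (hJ : ∀ i : Fin n, (K : ℕ) + 1 ≤ i → (J i).card = n - 1 - (i : ℕ)) {A : Finset (Fin n)}
    (hT : prodLin A K * tailProd J (K + 1) ∈ N) {h : XRing n}
    (hh : DegLE (staircase n (K + 1)) h) : prodLin A K * h ∈ N :=
  hG _ J (hN.succ.comap_mul K (Nat.lt_succ_self _) A) hJ hT h hh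

/-- Write $J_K=A\sqcup\{j\}\sqcup B$ and let $P_S(x)$ denote the product of the linear factors
indexed by $S$. Applying $\partial^{(\beta)}_K$ to $P_{J_K}(x_K)P_A(x_{K+1})T$, where
$P_A(x_K)P_A(x_{K+1})T$ is symmetric, gives $P_A(x_K)P_{A\cup B}(x_{K+1})T$ plus a multiple of
$P_{A\cup\{j\}}(x_K)$; the latter is covered by `ih`. -/
theorem Generates.prodLin_mul_tailProd_mem {K₁ : Fin n} (hK : (K₁ : ℕ) = K + 1)
    (hN : StableFrom K N) (hJ : ∀ i : Fin n, (K : ℕ) ≤ i → (J i).card = n - 1 - (i : ℕ))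
    (hbase : ∀ h, DegLE (staircase n (K + 1)) h → prodLin (J K) K * h ∈ N)
    {A : Finset (Fin n)} (hA : A ⊆ J K) {j : Fin n} (hj : j ∈ J K) (hjA : j ∉ A)
    (ih : ∀ h, DegLE (Function.update (staircase n (K + 1)) K ((J K).erase j \ A).card) h →
      prodLin (insert j A) K * h ∈ N) :
    prodLin A K * (prodLin ((J K).erase j) K₁ * tailProd J (K₁ + 1)) ∈ N := by
  have hne : K ≠ K₁ := by rintro rfl; omega
  set B := (J K).erase j \ A with hB
  have hAe : A ⊆ (J K).erase j := fun i hi =>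
    Finset.mem_erase.2 ⟨by rintro rfl; exact hjA hi, hA hi⟩
  have hcard : B.card + A.card + 1 = n - 1 - (K : ℕ) := by
    rw [hB, Finset.card_sdiff_add_card_eq_card hAe, Finset.card_erase_add_one hj, hJ K le_rfl]
  have hsplit : ∀ i, prodLin ((J K).erase j) i = prodLin A i * prodLin B i := fun i => by
    rw [mul_comm]
    exact (Finset.prod_sdiff hAe).symm
  have hsplit' : ∀ i, prodLin (J K) i = lin i j * (prodLin A i * prodLin B i) := fun i => by
    rw [← hsplit]
    exact (Finset.mul_prod_erase _ _ hj).symm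
  set T := tailProd J (K₁ + 1) with hTdef
  have hTdeg : DegLE (staircase n (K₁ + 1)) T := degLE_tailProd fun i hi => hJ i (by omega)
  have hmem : betaDiff K K₁ (prodLin (J K) K * (prodLin A K₁ * T)) ∈ N := by
    refine hN.betaDiff_mem K K₁ le_rfl hK _ (hbase _ (((degLE_prodLin A K₁).mul hTdeg).mono ?_))
    intro i
    simp only [staircase, Fin.ext_iff]
    split_ifs <;> omega
  have hsymm : swapX K K₁ (prodLin A K * prodLin A K₁ * T) = prodLin A K * prodLin A K₁ * T := by
    rw [swapX_mul, swapX_mul, swapX_prodLin_left, swapX_prodLin_right,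
      swapX_tailProd J (by omega) (by omega), mul_comm (prodLin A K₁)]
  -- The cofactor of the linear factor $j$ in the twisted Leibniz rule; only its degree matters.
  set E := betaDiff K K₁ (prodLin B K) - C (beta n) * prodLin B K₁ with hE
  have hEdeg : DegLE (fun i => if i = K ∨ i = K₁ then B.card else 0) E := by
    have hf := degLE_prodLin B K
    have hfK := hf K
    have hfK₁ := hf K₁
    simp only [if_true, hne.symm, if_false] at hfK hfK₁
    intro i
    refine (degreeOf_sub_le _ _ _).trans (max_le ?_ ((degreeOf_C_mul_le _ _ _).trans
      ((degLE_prodLin B K₁ i).trans ?_)))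
    · rcases eq_or_ne i K with rfl | hiK
      · simpa using degreeOf_betaDiff_left_le hne (hfK.trans (Nat.le_succ _))
          (hfK₁.trans (Nat.zero_le _))
      rcases eq_or_ne i K₁ with rfl | hiK₁
      · simpa using degreeOf_betaDiff_right_le hne (hfK.trans (Nat.le_succ _))
          (hfK₁.trans (Nat.zero_le _))
      · refine (degreeOf_betaDiff_other_le hne hiK hiK₁ _).trans ((hf i).trans ?_)
        simp [hiK]
    · by_cases hiK₁ : i = K₁ <;> simp [hiK₁]
  have hexpand : prodLin A K * (prodLin ((J K).erase j) K₁ * T)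
      = betaDiff K K₁ (prodLin (J K) K * (prodLin A K₁ * T))
        + C (-1) * (prodLin (insert j A) K * (prodLin A K₁ * T * E)) := by
    have h1 : prodLin (J K) K * (prodLin A K₁ * T)
        = prodLin A K * prodLin A K₁ * T * (lin K j * prodLin B K) := by
      rw [hsplit']; ring
    rw [h1, betaDiff_mul_of_symm hne hsymm, betaDiff_lin_mul hne, swapX_prodLin_left, ← hE,
      prodLin_insert hjA, hsplit, C_neg, C_1]
    ring
  rw [hexpand, ← MvPolynomial.smul_eq_C_mul]
  -- In $x_{K+1}$ the degrees add up to $|A|+|B|=n-1-(K+1)$, just within the staircase; in $x_K$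
  -- only `E` contributes, with at most $|B|$.
  refine N.add_mem hmem (N.smul_mem _ (ih _ ((((degLE_prodLin A K₁).mul hTdeg).mul hEdeg).mono ?_)))
  intro i
  simp only [staircase, Function.update_apply, Fin.ext_iff]
  split_ifs <;> omega

/-- Each linear factor removed from the product in $x_K$ allows one more power of $x_K$ in the
cofactor. The induction is on the number $m$ of removed factors, ending for $A=\emptyset$ with the
full degree. -/
theorem Generates.prodLin_mul_mem_of_update (hG : Generates n (K + 1)) (hN : StableFrom K N)
    (hJ : ∀ i : Fin n, (K : ℕ) ≤ i → (J i).card = n - 1 - (i : ℕ)) (hT : tailProd J K ∈ N)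
    {m : ℕ} {A : Finset (Fin n)} (hA : A ⊆ J K) (hm : A.card + m = (J K).card) {h : XRing n}
    (hh : DegLE (Function.update (staircase n (K + 1)) K m) h) : prodLin A K * h ∈ N := by
  have hz : staircase n (K + 1) K = 0 := by simp [staircase]
  have hJ' : ∀ i : Fin n, (K : ℕ) + 1 ≤ i → (J i).card = n - 1 - (i : ℕ) :=
    fun i hi => hJ i (by omega)
  rw [tailProd_eq_mul] at hT
  have hbase : ∀ h, DegLE (staircase n (K + 1)) h → prodLin (J K) K * h ∈ N :=
    fun h hh => hG.prodLin_mul_mem hN hJ' hT hh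
  induction m generalizing A h with
  | zero =>
    have hAJ : A = J K := Finset.eq_of_subset_of_card_le hA (by omega)
    rw [← hz, Function.update_eq_self] at hh
    rw [hAJ]
    exact hbase h hh
  | succ m ih =>
    obtain ⟨j, hj, hjA⟩ := Finset.exists_mem_notMem_of_card_lt_card (s := A) (t := J K) (by omega)
    have hcK := hJ K le_rfl
    have hK₁ : (K : ℕ) + 1 < n := by omega
    obtain ⟨K₁, hK⟩ : ∃ K₁ : Fin n, (K₁ : ℕ) = K + 1 := ⟨⟨K + 1, hK₁⟩, rfl⟩
    have hAe : A ⊆ (J K).erase j := fun i hi =>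
      Finset.mem_erase.2 ⟨by rintro rfl; exact hjA hi, hA hi⟩
    have hB : ((J K).erase j \ A).card = m := by
      have h1 := Finset.card_sdiff_add_card_eq_card hAe
      have h2 := Finset.card_erase_add_one hj
      omega
    have ih' : ∀ h, DegLE (Function.update (staircase n (K + 1)) K m) h →
        prodLin (insert j A) K * h ∈ N := fun h hh =>
      ih (Finset.insert_subset hj hA) (by rw [Finset.card_insert_of_notMem hjA]; omega) hh
    have hzero : ∀ h, DegLE (staircase n (K + 1)) h → prodLin A K * h ∈ N := by
      have hmem := prodLin_mul_tailProd_mem hK hN hJ hbase hA hj hjA (hB.symm ▸ ih')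
      intro h hh
      -- The index set at $K+1$ becomes $J_K\setminus\{j\}$, which again has $n-1-(K+1)$ elements.
      -- This is why arbitrary index sets of prescribed size are allowed in `Generates`.
      refine hG.prodLin_mul_mem (J := Function.update J K₁ ((J K).erase j)) hN ?_ ?_ hh
      · intro i hi
        rcases eq_or_ne i K₁ with rfl | hne
        · rw [Function.update_self, Finset.card_erase_of_mem hj]
          omega
        · rw [Function.update_of_ne hne]
          exact hJ' i hi
      · rw [← hK, tailProd_eq_mul, Function.update_self]
        rwa [tailProd_congr (J' := J)]
        intro i hi
        exact Function.update_of_ne (by rintro rfl; omega) _ _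
    refine mem_of_degLE_update (S := N.comap (LinearMap.mulLeft (YRing n) (prodLin A K))) hz ?_ hh
    intro s hs h hh
    rw [Submodule.mem_comap, LinearMap.mulLeft_apply]
    induction s with
    | zero => simpa using hzero h hh
    | succ s ihs =>
      -- Multiplied by $1+\beta y_j$, one factor $x_K$ becomes the linear factor $j$ plus $y_j$: the
      -- first term has a larger index set, the second a lower power of $x_K$.
      refine hN.mem_of_mul j _ ?_
      have hrw : C (1 + beta n * yVar j) * (prodLin A K * (xVar K ^ (s + 1) * h))
          = prodLin (insert j A) K * (xVar K ^ s * h)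
            + C (yVar j) * (prodLin A K * (xVar K ^ s * h)) := by
        rw [prodLin_insert hjA, lin, map_add, map_mul, map_one]
        ring
      rw [hrw]
      refine N.add_mem (ih' _ (((degLE_X_pow K s).mul hh).mono ?_)) ?_
      · intro i
        rcases eq_or_ne i K with rfl | hne
        · simp only [if_true, hz, Function.update_self]
          omega
        · simp [hne]
      · rw [← MvPolynomial.smul_eq_C_mul]
        exact N.smul_mem _ (ihs (by omega))

theorem Generates.of_succ (hG : Generates n (K + 1)) : Generates n K := by
  intro N J hN hJ hT h hh
  have hst : staircase n K = Function.update (staircase n (K + 1)) K (J K).card := by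
    funext i
    rw [Function.update_apply, hJ K le_rfl]
    simp only [staircase, Fin.ext_iff]
    split_ifs <;> omega
  rw [hst] at hh
  simpa [prodLin] using
    hG.prodLin_mul_mem_of_update hN hJ hT (A := ∅) (Finset.empty_subset _) (by simp) hh

end Step

/-- Descending induction on `k`. At $k=n$ the product is empty and the polynomials in question are
constants. -/
theorem generates (n : ℕ) {k : ℕ} (hk : k ≤ n) : Generates n k := by
  induction hk using Nat.decreasingInduction with
  | self =>
    intro N J _ _ hT h hh
    have hT' : tailProd J n = 1 := by
      refine Finset.prod_eq_one fun i hi => ?_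
      have := (Finset.mem_filter.1 hi).2
      omega
    rw [hT'] at hT
    have hC : h = C (coeff 0 h) := by
      rw [← vars_eq_empty_iff_eq_C, Finset.eq_empty_iff_forall_notMem]
      intro i hi
      refine mem_vars_iff_degreeOf_ne_zero.1 hi (Nat.le_zero.1 ((hh i).trans ?_))
      simp [staircase]
    rw [hC, ← mul_one (C _), ← MvPolynomial.smul_eq_C_mul]
    exact N.smul_mem _ hT
  | of_succ k hk ih => exact Generates.of_succ (K := ⟨k, hk⟩) ih

/-! ### The span of the β-double Schubert polynomials -/

/-- `∏_j (1 + β y_j)`. -/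
noncomputable def unitProd (n : ℕ) : YRing n := ∏ j : Fin n, (1 + beta n * yVar j)

/-- The span of the β-double Schubert polynomials over `ℤ[β][Y]`. -/
noncomputable def schubertSpan (n : ℕ) : Submodule (YRing n) (XRing n) :=
  Submodule.span (YRing n) (Set.range betaSchubert)

/-- The polynomials some multiple of which by a power of `∏_j (1 + β y_j)` is in `schubertSpan n`. -/
noncomputable def satSpan (n : ℕ) : Submodule (YRing n) (XRing n) where
  carrier := {f | ∃ k : ℕ, unitProd n ^ k • f ∈ schubertSpan n}
  zero_mem' := ⟨0, by simp⟩
  add_mem' := by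
    rintro f g ⟨k, hk⟩ ⟨l, hl⟩
    refine ⟨k + l, ?_⟩
    rw [smul_add]
    refine Submodule.add_mem _ ?_ ?_
    · rw [pow_add, mul_comm, mul_smul]
      exact Submodule.smul_mem _ _ hk
    · rw [pow_add, mul_smul]
      exact Submodule.smul_mem _ _ hl
  smul_mem' := by
    rintro r f ⟨k, hk⟩
    exact ⟨k, by rw [smul_comm]; exact Submodule.smul_mem _ _ hk⟩

/-- At an ascent the polynomial is already symmetric, so $\partial^{(\beta)}$ multiplies it by
$\beta$; at a descent the defining recursion yields another member of the family. -/
theorem betaDiff_betaSchubert_mem {n : ℕ} {a b : Fin n} (hab : (b : ℕ) = a + 1)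
    (w : Equiv.Perm (Fin n)) : betaDiff a b (betaSchubert w) ∈ schubertSpan n := by
  have hne : a ≠ b := by rintro rfl; omega
  rcases lt_or_ge (w a) (w b) with h | h
  · have hw := betaSchubert_eq_betaDiff w a b ⟨hab, h⟩
    rw [betaDiff_of_symm hne (by rw [hw, swapX_betaDiff hne]), ← MvPolynomial.smul_eq_C_mul]
    exact Submodule.smul_mem _ _ (Submodule.subset_span ⟨w, rfl⟩)
  · have hlt : w b < w a := lt_of_le_of_ne h fun e => hne (w.injective e.symm)
    have hasc : IsAscent (w * Equiv.swap a b) a b := ⟨hab, by simpa using hlt⟩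
    have hw := betaSchubert_eq_betaDiff _ a b hasc
    rw [mul_assoc, Equiv.swap_mul_self, mul_one] at hw
    rw [← hw]
    exact Submodule.subset_span ⟨_, rfl⟩

theorem betaDiff_mem_schubertSpan {n : ℕ} {a b : Fin n} (hab : (b : ℕ) = a + 1) {f : XRing n}
    (hf : f ∈ schubertSpan n) : betaDiff a b f ∈ schubertSpan n := by
  have hne : a ≠ b := by rintro rfl; omega
  suffices h : schubertSpan n ≤ (schubertSpan n).comap (betaDiffLinear hne) from h hf
  refine Submodule.span_le.2 ?_
  rintro _ ⟨w, rfl⟩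
  exact betaDiff_betaSchubert_mem hab w

theorem stableFrom_satSpan (n : ℕ) : StableFrom 0 (satSpan n) where
  betaDiff_mem a b _ hab f hf := by
    obtain ⟨k, hk⟩ := hf
    refine ⟨k, ?_⟩
    have hne : a ≠ b := by rintro rfl; omega
    have := betaDiff_mem_schubertSpan hab hk
    rwa [MvPolynomial.smul_eq_C_mul, betaDiff_C_mul hne, ← MvPolynomial.smul_eq_C_mul] at this
  mem_of_mul j f hf := by
    obtain ⟨k, hk⟩ := hf
    obtain ⟨e, he⟩ : (1 + beta n * yVar j) ∣ unitProd n :=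
      Finset.dvd_prod_of_mem _ (Finset.mem_univ j)
    refine ⟨k + 1, ?_⟩
    have h := Submodule.smul_mem _ e hk
    rwa [← MvPolynomial.smul_eq_C_mul, smul_smul, smul_smul, mul_comm e, mul_assoc, mul_comm e,
      ← he, ← pow_succ] at h

theorem topPoly_eq_tailProd (n : ℕ) :
    topPoly n = tailProd (fun i => Finset.univ.filter fun j : Fin n => (i : ℕ) + j + 2 ≤ n) 0 := by
  simp [topPoly, tailProd, prodLin, lin]

theorem mem_satSpan_of_degLE {n : ℕ} {f : XRing n}
    (hf : ∀ i : Fin n, degreeOf i f ≤ n - 1 - (i : ℕ)) : f ∈ satSpan n := by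
  refine generates n (Nat.zero_le n) _
    (fun i => Finset.univ.filter fun j : Fin n => (i : ℕ) + j + 2 ≤ n) (stableFrom_satSpan n)
    ?_ ?_ f (by simpa [DegLE, staircase] using hf)
  · intro i _
    have : (Finset.univ.filter fun j : Fin n => (i : ℕ) + j + 2 ≤ n)
        = Finset.univ.filter fun j : Fin n => (j : ℕ) < n - 1 - i := by
      ext j
      simp only [Finset.mem_filter, Finset.mem_univ, true_and]
      omega
    rw [this, Fin.card_filter_val_lt]
    omega
  · rw [← topPoly_eq_tailProd, ← betaSchubert_revPerm]
    exact ⟨0, by simpa [schubertSpan] using Submodule.subset_span (Set.mem_range_self _)⟩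

/-- The power of $\prod_j(1+\beta y_j)$ needed to enter the span is a unit in the localization and
can be divided out. -/
theorem exists_expansion {n : ℕ} {f : XRing n}
    (hf : ∀ i : Fin n, degreeOf i f ≤ n - 1 - (i : ℕ)) :
    ∃ c : Equiv.Perm (Fin n) → LocYRing n,
      toLoc f = ∑ w : Equiv.Perm (Fin n), C (c w) * toLoc (betaSchubert w) := by
  obtain ⟨k, hk⟩ := mem_satSpan_of_degLE hf
  obtain ⟨c, hc⟩ := (Submodule.mem_span_range_iff_exists_fun _).1 hk
  have hu : IsUnit (algebraMap (YRing n) (LocYRing n) (unitProd n) ^ k) :=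
    (IsLocalization.Away.algebraMap_isUnit (∏ j : Fin n, (1 + beta n * yVar j))).pow k
  obtain ⟨u, hu⟩ := hu
  refine ⟨fun w => ↑u⁻¹ * algebraMap _ _ (c w), ?_⟩
  have h := congrArg toLoc hc
  simp only [toLoc, map_sum, MvPolynomial.smul_eq_C_mul, map_mul, MvPolynomial.map_C] at h
  rw [map_pow, ← hu] at h
  simp only [toLoc, map_mul, mul_assoc, ← Finset.mul_sum]
  rw [h, ← mul_assoc, ← C_mul, Units.inv_mul, C_1, one_mul]

end BetaSchubert

theorem mainTheorem6 (p q : ℕ) :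
    (∀ γ : Clan p q, γ.NonCrossing →
      ∀ κ : Fin (p + q) →₀ ℕ, MvPolynomial.coeff κ γ.schubertProduct ≠ 0 →
        ∀ i : Fin (p + q), κ i ≤ p + q - 1 - (i : ℕ)) ∧
    (∀ (τ : Clan p q) (hτ : τ.Matchless),
      ∃ c : Equiv.Perm (Fin (p + q)) → LocYRing (p + q),
        toLoc (τ.upsilon hτ) =
          ∑ w : Equiv.Perm (Fin (p + q)), MvPolynomial.C (c w) * toLoc (BetaSchubert.betaSchubert w)) :=
  ⟨fun γ _ _ hκ i => (monomial_le_degreeOf i (mem_support_iff.2 hκ)).trans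
      (γ.degreeOf_schubertProduct_le i),
    fun τ _ => BetaSchubert.exists_expansion τ.degreeOf_schubertProduct_le⟩
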